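/- Let $F_1,\dots,F_m$ be subsets of a finite set $E$, let $k$ be a positive integer and let $\rho:\{F_1,\dots,F_m\}\to\mathbb{Z}$ be a function. Write $F_I=\bigcup_{i\in I}F_i$ for $I\subseteq[m]=\{1,\dots,m\}$ and $\eta(F_i)=|F_i|-\rho(F_i)$, and suppose that (1) $0<\rho(F_i)<|F_i|$ for all $i\in[m]$; (2) $F_{[m]}=E$; (3) $k\le |F_{[m]}|-\sum_{i\in[m]}\eta(F_i)$; (4) $|F_{[m]\setminus\{j\}}\cap F_j|<\rho(F_j)$ for all $j\in[m]$. Let $\mathcal{Z}_{<k}=\{F_J : J\subseteq[m],\ |F_I|-\sum_{i\in I}\eta(F_i)<k \text{ for all } I\subseteq J\}$, and let $M=M(F_1,\dots,F_m;k;\rho)$ be the matroid on $E$ whose collection of cyclic flats (flats that are unions of circuits) is $\mathcal{Z}_{<k}\cup\{E\}$ and whose rank function takes the value $|F_I|-\sum_{i\in I}\eta(F_i)$ at each $F_I\in\mathcal{Z}_{<k}$ and the value $k$ at $E$. Let its parameters $(n,k,d,r,\delta)$ be given by $n=|E|$, $k=\operatorname{rank}(M)$, $d=\min\{|X| : X \text{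 is a circuit of the dual matroid } M^*\}$, $r=\max_{i\in[m]}\rho(F_i)$ and $\delta-1=\min_{i\in[m]}\eta(F_i)$. Assume $r<k$ and put $a=\lceil k/r\rceil r-k$. Then $$d=n-k+1-\left(\left\lceil \tfrac{k}{r}\right\rceil-1\right)(\delta-1)$$ if and only if both of the following conditions hold: (i) $|F_T|\ge\lceil k/r\rceil(r+\delta-1)-a$ for every $T\subseteq[m]$ with $|T|=\lceil k/r\rceil$; (ii) $\eta(F_i)=\delta-1$ for every $i\in[m]$. -/

import Mathlib

open Finset

namespace LocalMatroid

section Data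

variable {α : Type*} [DecidableEq α] {m : ℕ}

/-- The union `F_I = ⋃_{i ∈ I} F_i`. -/
def atomUnion (F : Fin m → Finset α) (I : Finset (Fin m)) : Finset α := I.biUnion F

/-- The nullity `η(F_i) = |F_i| - ρ(F_i)`. -/
def atomNullity (F : Fin m → Finset α) (rho : Fin m → ℤ) (i : Fin m) : ℤ := (#(F i) : ℤ) - rho i

/-- The number `|F_I| - ∑_{i ∈ I} η(F_i)`. -/
def expectedRank (F : Fin m → Finset α) (rho : Fin m → ℤ) (I : Finset (Fin m)) : ℤ :=
  (#(atomUnion F I) : ℤ) - ∑ i ∈ I, atomNullity F rho i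

/-- The conditions on the sets `F_1, …, F_m`, the positive integer `k` and the integers
`rho i = ρ(F_i)` under which they define a matroid on `E`. The last condition forces the sets `F_i`
to be pairwise distinct, so that a function of the index `i` is the same as a function of `F_i`. -/
structure IsAtomSystem (E : Finset α) (F : Fin m → Finset α) (rho : Fin m → ℤ) (k : ℤ) : Prop where
  k_pos : 0 < k
  rho_pos : ∀ i, 0 < rho i
  rho_lt : ∀ i, rho i < #(F i)
  union_eq : atomUnion F univ = E
  k_le : k ≤ (#(atomUnion F univ) : ℤ) - ∑ i, atomNullity F rho i
  inter_lt : ∀ j, (#(atomUnion F (univ \ {j}) ∩ F j) : ℤ) < rho j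

/-- `J` indexes a member `F_J` of the family `𝒵_{<k}`:
`|F_I| - ∑_{i ∈ I} η(F_i) < k` for all `I ⊆ J`. -/
def IsLow (F : Fin m → Finset α) (rho : Fin m → ℤ) (k : ℤ) (J : Finset (Fin m)) : Prop :=
  ∀ I ⊆ J, expectedRank F rho I < k

end Data

section Cyclic

variable {α : Type*}

/-- A cyclic set of a matroid: a union of circuits. -/
def IsCyclic (M : Matroid α) (X : Set α) : Prop :=
  ∃ C : Set (Set α), (∀ c ∈ C, M.IsCircuit c) ∧ X = ⋃₀ C

/-- A cyclic flat of a matroid: a flat that is a union of circuits. -/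
def IsCyclicFlat (M : Matroid α) (X : Set α) : Prop := M.IsFlat X ∧ IsCyclic M X

/-- The rank of a set in a matroid, as an integer (only used for matroids on finite sets, where
`M.eRk X` is finite). -/
noncomputable def rank (M : Matroid α) (X : Set α) : ℤ := ((M.eRk X).toNat : ℤ)

end Cyclic

/-- `M` is the matroid `M(F_1, …, F_m; k; ρ)` on `E`: the collection of its cyclic flats is
`𝒵 = 𝒵_{<k} ∪ {E}`, and its rank function restricted to `𝒵` takes the value
`|F_I| - ∑_{i ∈ I} η(F_i)` at `F_I ∈ 𝒵_{<k}` and the value `k` at `E`. -/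
structure IsMatroidOf {α : Type*} [DecidableEq α] {m : ℕ} (M : Matroid α) (E : Finset α)
    (F : Fin m → Finset α) (rho : Fin m → ℤ) (k : ℤ) : Prop where
  ground_eq : M.E = (E : Set α)
  isCyclicFlat_iff : ∀ X : Set α, IsCyclicFlat M X ↔
    X = (E : Set α) ∨ ∃ J, IsLow F rho k J ∧ X = (atomUnion F J : Set α)
  rank_low : ∀ J, IsLow F rho k J → rank M (atomUnion F J : Set α) = expectedRank F rho J
  rank_ground : rank M (E : Set α) = k

/-- `(n, k, d, r, δ)` are the parameters of the matroid `M = M(F_1, …, F_m; k; ρ)` on `E`, where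
`d` is the least size of a circuit of the dual matroid. -/
structure HasParameters {α : Type*} [DecidableEq α] {m : ℕ} (M : Matroid α) (E : Finset α)
    (F : Fin m → Finset α) (rho : Fin m → ℤ) (n k d r δ : ℤ) : Prop where
  n_eq : n = #E
  k_eq : k = rank M (E : Set α)
  d_isLeast : IsLeast {x : ℤ | ∃ X : Set α, M✶.IsCircuit X ∧ (X.ncard : ℤ) = x} d
  r_isGreatest : IsGreatest (Set.range rho) r
  delta_isLeast : IsLeast (Set.range (atomNullity F rho)) (δ - 1)

/-! Facts on closures and cyclic sets in a finite matroid. -/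

section CyclicFacts

variable {α : Type*}

lemma mem_closure_iff_eRk {M : Matroid α} (hfin : M.E.Finite) {X : Set α} (hX : X ⊆ M.E) {x : α}
    (hx : x ∈ M.E) : x ∈ M.closure X ↔ M.eRk (insert x X) = M.eRk X := by
  constructor
  · intro hcl
    rw [← Matroid.eRk_closure_eq, Matroid.closure_insert_eq_of_mem_closure hcl,
      Matroid.eRk_closure_eq]
  · intro he
    obtain ⟨I, hI⟩ := M.exists_isBasis X
    by_contra hcl
    have hI' : x ∉ M.closure I := by rwa [hI.closure_eq_closure]
    have hind : M.Indep (insert x I) := by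
      by_contra hni
      apply hI'
      rw [hI.indep.mem_closure_iff']
      exact ⟨hx, fun hh => absurd hh hni⟩
    have h1 := hind.encard_le_eRk_of_subset (Set.insert_subset_insert hI.subset : _ ⊆ insert x X)
    have hxI : x ∉ I := fun hh => hI' (M.mem_closure_of_mem hh hI.indep.subset_ground)
    rw [he, ← hI.encard_eq_eRk, Set.encard_insert_of_notMem hxI] at h1
    have hIf : I.Finite := hfin.subset hI.indep.subset_ground
    rw [← hIf.cast_ncard_eq] at h1
    have : I.ncard + 1 ≤ I.ncard := by exact_mod_cast h1
    omega

/-- A set is cyclic if and only if the removal of any one of its elements keeps the rank. -/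
lemma isCyclic_iff {M : Matroid α} (hfin : M.E.Finite) {X : Set α} (hX : X ⊆ M.E) :
    IsCyclic M X ↔ ∀ x ∈ X, M.eRk (X \ {x}) = M.eRk X := by
  have key : ∀ x ∈ X, (M.eRk (X \ {x}) = M.eRk X ↔ ∃ C ⊆ X, M.IsCircuit C ∧ x ∈ C) := by
    intro x hx
    have h1 := mem_closure_iff_eRk hfin (X := X \ {x}) (Set.sdiff_subset.trans hX) (hX hx)
    rw [Set.insert_sdiff_singleton, Set.insert_eq_of_mem hx] at h1
    have h2 := Matroid.mem_closure_iff_exists_isCircuit (M := M) (e := x) (X := X \ {x}) (by simp)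
    rw [Set.insert_sdiff_singleton, Set.insert_eq_of_mem hx] at h2
    rw [← h2, h1, eq_comm]
  constructor
  · rintro ⟨S, hS, rfl⟩ x hx
    obtain ⟨C, hC, hxC⟩ := hx
    exact (key x ⟨C, hC, hxC⟩).2 ⟨C, Set.subset_sUnion_of_mem hC, hS C hC, hxC⟩
  · intro hall
    refine ⟨{C | M.IsCircuit C ∧ C ⊆ X}, fun c hc => hc.1, ?_⟩
    apply Set.Subset.antisymm
    · intro x hx
      obtain ⟨C, hCX, hC, hxC⟩ := (key x hx).1 (hall x hx)
      exact ⟨C, ⟨hC, hCX⟩, hxC⟩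
    · exact Set.sUnion_subset fun C hC => hC.2

end CyclicFacts

/-! Existence of the matroid `M(F_1, …, F_m; k; ρ)`. -/

section Existence

variable {α : Type*} [DecidableEq α] {m : ℕ} {E : Finset α} {F : Fin m → Finset α}
  {rho : Fin m → ℤ} {k : ℤ}

lemma atomNullity_pos (h : IsAtomSystem E F rho k) (i : Fin m) : 0 < atomNullity F rho i := by
  have := h.rho_lt i
  unfold atomNullity
  omega

lemma atomUnion_mono {I J : Finset (Fin m)} (hIJ : I ⊆ J) : atomUnion F I ⊆ atomUnion F J :=
  Finset.biUnion_subset_biUnion_of_subset_left _ hIJ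

lemma atomUnion_subset (h : IsAtomSystem E F rho k) (J : Finset (Fin m)) : atomUnion F J ⊆ E := by
  rw [← h.union_eq]
  exact atomUnion_mono (Finset.subset_univ _)

lemma atom_subset (J : Finset (Fin m)) {j : Fin m} (hj : j ∈ J) : F j ⊆ atomUnion F J :=
  Finset.subset_biUnion_of_mem F hj

lemma atomUnion_union (I J : Finset (Fin m)) :
    atomUnion F (I ∪ J) = atomUnion F I ∪ atomUnion F J := by
  ext x; simp only [atomUnion, mem_biUnion, mem_union]; grind

/-- Independence in the matroid. -/
def IndepSet (E : Finset α) (F : Fin m → Finset α) (rho : Fin m → ℤ) (k : ℤ) (X : Finset α) :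
    Prop :=
  X ⊆ E ∧ (#X : ℤ) ≤ k ∧
    ∀ J, (#X : ℤ) + ∑ i ∈ J, atomNullity F rho i ≤ #(atomUnion F J ∪ X)

/-- The elements of `F_j` that lie in no other `F_i`. -/
def ownPart (F : Fin m → Finset α) (j : Fin m) : Finset α := F j \ atomUnion F (univ \ {j})

lemma nullity_lt_ownPart (h : IsAtomSystem E F rho k) (j : Fin m) :
    atomNullity F rho j < #(ownPart F j) := by
  have h1 := h.inter_lt j
  have h2 := Finset.card_sdiff_add_card_inter (F j) (atomUnion F (univ \ {j}))
  rw [Finset.inter_comm] at h2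
  unfold atomNullity ownPart
  omega

/-- A set that avoids pairwise disjoint sets `U_j ⊆ F_j` of sizes `η(F_j)` is independent. -/
lemma indepSet_of_disjoint (U : Fin m → Finset α)
    (hU : ∀ j, U j ⊆ F j) (hc : ∀ j, (#(U j) : ℤ) = atomNullity F rho j)
    (hd : ∀ i j, i ≠ j → Disjoint (U i) (U j)) (X : Finset α) (hX : X ⊆ E) (hk : (#X : ℤ) ≤ k)
    (hXU : ∀ j, Disjoint X (U j)) : IndepSet E F rho k X := by
  refine ⟨hX, hk, fun J => ?_⟩
  have h1 : ∑ i ∈ J, atomNullity F rho i = (#(J.biUnion U) : ℤ) := by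
    rw [Finset.card_biUnion (fun i _ j _ hij => hd i j hij)]
    push_cast
    exact Finset.sum_congr rfl fun i _ => (hc i).symm
  have h2 : Disjoint X (J.biUnion U) := by
    rw [Finset.disjoint_biUnion_right]
    exact fun i _ => hXU i
  rw [h1]
  have h3 : #X + #(J.biUnion U) ≤ #(atomUnion F J ∪ X) := by
    rw [← Finset.card_union_of_disjoint h2]
    apply Finset.card_le_card
    apply Finset.union_subset Finset.subset_union_right
    exact (Finset.biUnion_mono fun i _ => hU i).trans Finset.subset_union_left
  exact_mod_cast h3

/-- The sets `U_j` can be chosen in the private parts of the `F_j`, except that one prescribed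
element `x` may be put into `U_{j₀}` for a prescribed `j₀` with `x ∈ F_{j₀}`. -/
lemma exists_choice (h : IsAtomSystem E F rho k) {x : α} {j₀ : Fin m} (hx : x ∈ F j₀) :
    ∃ U : Fin m → Finset α, (∀ j, U j ⊆ F j) ∧
      (∀ j, (#(U j) : ℤ) = atomNullity F rho j) ∧ (∀ i j, i ≠ j → Disjoint (U i) (U j)) ∧
      x ∈ U j₀ ∧ (∀ j, j ≠ j₀ → U j ⊆ ownPart F j) := by
  have key : ∀ j, ∃ V ⊆ ownPart F j, x ∉ V ∧
      (#V : ℤ) = atomNullity F rho j - if j = j₀ then 1 else 0 := by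
    intro j
    have h1 := nullity_lt_ownPart h j
    have h2 := atomNullity_pos h j
    have h3 : #(ownPart F j) - 1 ≤ #((ownPart F j).erase x) := Finset.pred_card_le_card_erase
    obtain ⟨V, hV, hVc⟩ := Finset.exists_subset_card_eq
      (s := (ownPart F j).erase x) (n := (atomNullity F rho j - if j = j₀ then 1 else 0).toNat)
      (by split_ifs <;> omega)
    refine ⟨V, hV.trans (Finset.erase_subset _ _), fun hxV => by simpa using hV hxV, ?_⟩
    rw [hVc]
    split_ifs <;> omega
  choose V hV hxV hVc using key
  have hVF : ∀ j, V j ⊆ F j := fun j => (hV j).trans Finset.sdiff_subset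
  have hVV : ∀ i j, i ≠ j → Disjoint (V i) (V j) := by
    intro i j hij
    rw [Finset.disjoint_left]
    intro y hyi hyj
    have h1 := hV j hyj
    simp only [ownPart, mem_sdiff] at h1
    exact h1.2 (atom_subset _ (by simpa using hij) (hVF i hyi))
  refine ⟨fun j => if j = j₀ then insert x (V j) else V j, ?_, ?_, ?_, ?_, ?_⟩
  · intro j
    dsimp only
    split_ifs with hj
    · subst hj; exact Finset.insert_subset hx (hVF j)
    · exact hVF j
  · intro j
    have := hVc j
    dsimp only
    split_ifs with hj
    · rw [Finset.card_insert_of_notMem (hxV j)]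
      simp only [hj, if_true] at this ⊢
      push_cast
      omega
    · simpa [hj] using this
  · intro i j hij
    have := hVV i j hij
    dsimp only
    split_ifs with hi hj hj
    · exact absurd (hi.trans hj.symm) hij
    · simpa [Finset.disjoint_insert_left, hxV j] using this
    · simpa [Finset.disjoint_insert_right, hxV i] using this
    · exact this
  · simp
  · intro j hj
    simpa [hj] using hV j

/-- The sets `U_j` can be chosen in the private parts of the `F_j` so as to avoid a given
element. -/
lemma exists_choice_avoid (h : IsAtomSystem E F rho k) (x : α) :
    ∃ U : Fin m → Finset α, (∀ j, U j ⊆ ownPart F j) ∧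
      (∀ j, (#(U j) : ℤ) = atomNullity F rho j) ∧ (∀ i j, i ≠ j → Disjoint (U i) (U j)) ∧
      (∀ j, x ∉ U j) := by
  have key : ∀ j, ∃ V ⊆ ownPart F j, x ∉ V ∧ (#V : ℤ) = atomNullity F rho j := by
    intro j
    have h1 := nullity_lt_ownPart h j
    have h2 := atomNullity_pos h j
    have h3 : #(ownPart F j) - 1 ≤ #((ownPart F j).erase x) := Finset.pred_card_le_card_erase
    obtain ⟨V, hV, hVc⟩ := Finset.exists_subset_card_eq
      (s := (ownPart F j).erase x) (n := (atomNullity F rho j).toNat) (by omega)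
    refine ⟨V, hV.trans (Finset.erase_subset _ _), fun hxV => by simpa using hV hxV, ?_⟩
    rw [hVc]
    omega
  choose V hV hxV hVc using key
  refine ⟨V, hV, hVc, fun i j hij => ?_, hxV⟩
  rw [Finset.disjoint_left]
  intro y hyi hyj
  have h1 := hV j hyj
  simp only [ownPart, mem_sdiff] at h1
  exact h1.2 (atom_subset _ (by simpa using hij) ((mem_sdiff.1 (hV i hyi)).1))

lemma ownPart_disjoint {j : Fin m} {J : Finset (Fin m)} (hj : j ∉ J) :
    Disjoint (ownPart F j) (atomUnion F J) := by
  rw [Finset.disjoint_left]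
  intro y hy hyJ
  refine (mem_sdiff.1 hy).2 (atomUnion_mono (fun i hi => ?_) hyJ)
  simp only [mem_sdiff, mem_univ, mem_singleton, true_and]
  rintro rfl
  exact hj hi

/-- Removing sets `U_j` with `j ∈ J` from `F_J` leaves `|F_J| - ∑_{j ∈ J} η(F_j)` elements. -/
lemma card_sdiff_choice (U : Fin m → Finset α)
    (hU : ∀ j, U j ⊆ F j) (hc : ∀ j, (#(U j) : ℤ) = atomNullity F rho j)
    (hd : ∀ i j, i ≠ j → Disjoint (U i) (U j)) (J : Finset (Fin m)) :
    (#(atomUnion F J \ J.biUnion U) : ℤ) = expectedRank F rho J := by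
  have h1 : ∑ i ∈ J, atomNullity F rho i = (#(J.biUnion U) : ℤ) := by
    rw [Finset.card_biUnion (fun i _ j _ hij => hd i j hij)]
    push_cast
    exact Finset.sum_congr rfl fun i _ => (hc i).symm
  have h2 : J.biUnion U ⊆ atomUnion F J := Finset.biUnion_mono fun i _ => hU i
  have h3 := Finset.card_sdiff_add_card_eq_card h2
  rw [expectedRank, h1]
  omega

lemma expectedRank_le_insert (h : IsAtomSystem E F rho k) (j : Fin m) (J : Finset (Fin m)) :
    expectedRank F rho J ≤ expectedRank F rho (insert j J) := by
  by_cases hj : j ∈ J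
  · rw [Finset.insert_eq_of_mem hj]
  have h1 := nullity_lt_ownPart h j
  have h2 : #(ownPart F j) + #(atomUnion F J) ≤ #(atomUnion F (insert j J)) := by
    rw [← Finset.card_union_of_disjoint (ownPart_disjoint hj)]
    apply Finset.card_le_card
    apply Finset.union_subset
    · exact Finset.sdiff_subset.trans (atom_subset _ (Finset.mem_insert_self j J))
    · exact atomUnion_mono (Finset.subset_insert j J)
  unfold expectedRank
  rw [Finset.sum_insert hj]
  omega

lemma expectedRank_mono (h : IsAtomSystem E F rho k) {I J : Finset (Fin m)} (hIJ : I ⊆ J) :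
    expectedRank F rho I ≤ expectedRank F rho J := by
  have key : ∀ K : Finset (Fin m), expectedRank F rho I ≤ expectedRank F rho (I ∪ K) := by
    intro K
    induction K using Finset.induction_on with
    | empty => simp
    | insert j K _ ih =>
      rw [Finset.union_insert]
      exact ih.trans (expectedRank_le_insert h j _)
  have := key J
  rwa [Finset.union_eq_right.2 hIJ] at this

lemma isLow_iff (h : IsAtomSystem E F rho k) (J : Finset (Fin m)) :
    IsLow F rho k J ↔ expectedRank F rho J < k :=
  ⟨fun hJ => hJ J subset_rfl, fun hJ _ hI => (expectedRank_mono h hI).trans_lt hJ⟩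

lemma indepSet_mono {X Y : Finset α} (hY : IndepSet E F rho k Y) (hXY : X ⊆ Y) :
    IndepSet E F rho k X := by
  obtain ⟨h1, h2, h3⟩ := hY
  have hc := Finset.card_le_card hXY
  refine ⟨hXY.trans h1, by omega, fun J => ?_⟩
  have h4 := h3 J
  have h5 : #(atomUnion F J ∪ Y) ≤ #(atomUnion F J ∪ X) + #(Y \ X) := by
    refine (Finset.card_le_card ?_).trans (Finset.card_union_le _ _)
    intro y; simp only [mem_union, mem_sdiff]; tauto
  have h6 := Finset.card_sdiff_add_card_eq_card hXY
  omega

/-- The index sets `J` whose inequality is an equality at `X` are closed under unions. -/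
lemma tight_union {X : Finset α} (hX : IndepSet E F rho k X) {J K : Finset (Fin m)}
    (hJ : (#X : ℤ) + ∑ i ∈ J, atomNullity F rho i = #(atomUnion F J ∪ X))
    (hK : (#X : ℤ) + ∑ i ∈ K, atomNullity F rho i = #(atomUnion F K ∪ X)) :
    (#X : ℤ) + ∑ i ∈ J ∪ K, atomNullity F rho i = #(atomUnion F (J ∪ K) ∪ X) := by
  have h1 := hX.2.2 (J ∪ K)
  have h2 := hX.2.2 (J ∩ K)
  have h3 := Finset.sum_union_inter (s₁ := J) (s₂ := K) (f := atomNullity F rho)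
  have h4 := Finset.card_union_add_card_inter (atomUnion F J ∪ X) (atomUnion F K ∪ X)
  have h5 : atomUnion F (J ∪ K) ∪ X = (atomUnion F J ∪ X) ∪ (atomUnion F K ∪ X) := by
    rw [atomUnion_union]; ext y; simp only [mem_union]; tauto
  have h6 : #(atomUnion F (J ∩ K) ∪ X) ≤ #((atomUnion F J ∪ X) ∩ (atomUnion F K ∪ X)) := by
    apply Finset.card_le_card
    intro y
    simp only [mem_union, mem_inter]
    rintro (hy | hy)
    · exact ⟨Or.inl (atomUnion_mono Finset.inter_subset_left hy),
        Or.inl (atomUnion_mono Finset.inter_subset_right hy)⟩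
    · exact ⟨Or.inr hy, Or.inr hy⟩
  rw [← h5] at h4
  omega

lemma exists_tight {X : Finset α} (hX : IndepSet E F rho k X) (hk : (#X : ℤ) < k)
    {S : Finset α} (hS : ∀ e ∈ S, e ∈ E ∧ e ∉ X ∧ ¬ IndepSet E F rho k (insert e X)) :
    ∃ J, (#X : ℤ) + ∑ i ∈ J, atomNullity F rho i = #(atomUnion F J ∪ X) ∧ S ⊆ atomUnion F J := by
  induction S using Finset.induction_on with
  | empty => exact ⟨∅, by simp [atomUnion], by simp⟩
  | insert e S _ ih =>
    obtain ⟨J, hJ, hSJ⟩ := ih fun x hx => hS x (Finset.mem_insert_of_mem hx)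
    obtain ⟨heE, heX, hni⟩ := hS e (Finset.mem_insert_self e S)
    have hcard := Finset.card_insert_of_notMem heX
    have : ∃ K, #(atomUnion F K ∪ insert e X) < (#(insert e X) : ℤ) +
        ∑ i ∈ K, atomNullity F rho i := by
      by_contra! hcon
      exact hni ⟨Finset.insert_subset heE hX.1, by omega, hcon⟩
    obtain ⟨K, hK⟩ := this
    have h1 := hX.2.2 K
    have h2 : #(atomUnion F K ∪ X) ≤ #(atomUnion F K ∪ insert e X) :=
      Finset.card_le_card (Finset.union_subset_union_right (Finset.subset_insert e X))
    have h3 : (#X : ℤ) + ∑ i ∈ K, atomNullity F rho i = #(atomUnion F K ∪ X) := by omega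
    have h4 : atomUnion F K ∪ X = atomUnion F K ∪ insert e X :=
      Finset.eq_of_subset_of_card_le
        (Finset.union_subset_union_right (Finset.subset_insert e X)) (by omega)
    have h5 : e ∈ atomUnion F K := by
      have : e ∈ atomUnion F K ∪ X := by rw [h4]; simp
      exact (Finset.mem_union.1 this).resolve_right heX
    refine ⟨J ∪ K, tight_union hX hJ h3, ?_⟩
    rw [atomUnion_union]
    apply Finset.insert_subset
    · exact Finset.mem_union_right _ h5
    · exact hSJ.trans Finset.subset_union_left

lemma indepSet_aug {X Y : Finset α} (hX : IndepSet E F rho k X) (hY : IndepSet E F rho k Y)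
    (hXY : #X < #Y) : ∃ e ∈ Y, e ∉ X ∧ IndepSet E F rho k (insert e X) := by
  by_contra! hcon
  have hYk := hY.2.1
  obtain ⟨J, hJ, hYJ⟩ := exists_tight hX (by omega) (S := Y \ X) (fun e he =>
    ⟨hY.1 (mem_sdiff.1 he).1, (mem_sdiff.1 he).2, hcon e (mem_sdiff.1 he).1 (mem_sdiff.1 he).2⟩)
  have h1 := hY.2.2 J
  have h2 : #(atomUnion F J ∪ Y) ≤ #(atomUnion F J ∪ X) := by
    apply Finset.card_le_card
    apply Finset.union_subset Finset.subset_union_left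
    intro y hy
    by_cases hyX : y ∈ X
    · exact Finset.mem_union_right _ hyX
    · exact Finset.mem_union_left _ (hYJ (mem_sdiff.2 ⟨hy, hyX⟩))
  omega

lemma indepSet_empty (h : IsAtomSystem E F rho k) : IndepSet E F rho k ∅ := by
  refine ⟨by simp, by simpa using h.k_pos.le, fun J => ?_⟩
  have h1 := expectedRank_mono h (Finset.empty_subset J)
  simp only [expectedRank, atomUnion, biUnion_empty, card_empty, sum_empty] at h1
  simp only [atomUnion, card_empty, Finset.union_empty]
  push_cast at h1 ⊢
  omega

/-- The matroid `M(F_1, …, F_m; k; ρ)`, by its independent sets. -/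
noncomputable def matroidOf (h : IsAtomSystem E F rho k) : Matroid α :=
  (IndepMatroid.ofFinset (E : Set α) (IndepSet E F rho k) (indepSet_empty h)
    (fun _ _ hJ hIJ => indepSet_mono hJ hIJ) (fun _ _ hI hJ hIJ => indepSet_aug hI hJ hIJ)
    (fun _ hI => by exact_mod_cast hI.1)).matroid

lemma matroidOf_ground (h : IsAtomSystem E F rho k) : (matroidOf h).E = (E : Set α) := rfl

lemma matroidOf_indep (h : IsAtomSystem E F rho k) (X : Finset α) :
    (matroidOf h).Indep (X : Set α) ↔ IndepSet E F rho k X :=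
  IndepMatroid.ofFinset_indep (E : Set α) (IndepSet E F rho k) (indepSet_empty h)
    (fun _ _ hJ hIJ => indepSet_mono hJ hIJ) (fun _ _ hI hJ hIJ => indepSet_aug hI hJ hIJ)
    (fun _ hI => by exact_mod_cast hI.1)

/-- The rank of a set `X` is `c` if it contains an independent set of size `c` and no larger one. -/
lemma eRk_eq_of (h : IsAtomSystem E F rho k) (X : Finset α) (c : ℕ)
    (hex : ∃ I ⊆ X, IndepSet E F rho k I ∧ #I = c)
    (hle : ∀ I ⊆ X, IndepSet E F rho k I → #I ≤ c) : (matroidOf h).eRk (X : Set α) = c := by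
  apply le_antisymm
  · rw [Matroid.eRk_le_iff]
    intro I hIX hI
    lift I to Finset α using X.finite_toSet.subset hIX
    rw [matroidOf_indep] at hI
    rw [Set.encard_coe_eq_coe_finsetCard]
    exact_mod_cast hle I (by exact_mod_cast hIX) hI
  · obtain ⟨I, hIX, hI, rfl⟩ := hex
    rw [Matroid.le_eRk_iff]
    exact ⟨I, by exact_mod_cast hIX, (matroidOf_indep h I).2 hI,
      Set.encard_coe_eq_coe_finsetCard I⟩

lemma card_le_expectedRank {X : Finset α} (hX : IndepSet E F rho k X) {J : Finset (Fin m)}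
    (hXJ : X ⊆ atomUnion F J) : (#X : ℤ) ≤ expectedRank F rho J := by
  have := hX.2.2 J
  rw [Finset.union_eq_left.2 hXJ] at this
  unfold expectedRank
  omega

/-- A union `F_J` of expected rank at most `k` keeps an independent set of that size after the
removal of any one element. -/
lemma exists_indep_erase (h : IsAtomSystem E F rho k) (J : Finset (Fin m)) (x : α)
    (hx : x ∈ atomUnion F J) : ∃ I ⊆ (atomUnion F J).erase x, IndepSet E F rho k I ∧
      (#I : ℤ) = min k (expectedRank F rho J) := by
  obtain ⟨j₀, hj₀, hxj⟩ := Finset.mem_biUnion.1 hx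
  obtain ⟨U, hU, hc, hd, hxU, hown⟩ := exists_choice h hxj
  have h1 := card_sdiff_choice U hU hc hd J
  have hk := h.k_pos
  obtain ⟨I, hI, hIc⟩ := Finset.exists_subset_card_eq
    (s := atomUnion F J \ J.biUnion U) (n := (min k (expectedRank F rho J)).toNat) (by omega)
  have hIc' : (#I : ℤ) = min k (expectedRank F rho J) := by omega
  refine ⟨I, fun y hy => ?_, ?_, hIc'⟩
  · have h2 := mem_sdiff.1 (hI hy)
    refine Finset.mem_erase.2 ⟨?_, h2.1⟩
    rintro rfl
    exact h2.2 (Finset.mem_biUnion.2 ⟨j₀, hj₀, hxU⟩)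
  · refine indepSet_of_disjoint U hU hc hd I
      (hI.trans (Finset.sdiff_subset.trans (atomUnion_subset h J))) (by omega) fun j => ?_
    by_cases hj : j ∈ J
    · rw [Finset.disjoint_left]
      intro y hy hyU
      exact (mem_sdiff.1 (hI hy)).2 (Finset.mem_biUnion.2 ⟨j, hj, hyU⟩)
    · have hne : j ≠ j₀ := fun hh => hj (hh ▸ hj₀)
      exact ((ownPart_disjoint hj).mono_left (hown j hne)).symm.mono_left
        (hI.trans Finset.sdiff_subset)

/-- Outside a union `F_J` of expected rank below `k`, every element raises the rank. -/
lemma exists_indep_insert (h : IsAtomSystem E F rho k) (J : Finset (Fin m))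
    (hJ : expectedRank F rho J < k) (x : α) (hxE : x ∈ E) :
    ∃ I ⊆ atomUnion F J, IndepSet E F rho k (insert x I) ∧ (#I : ℤ) = expectedRank F rho J := by
  obtain ⟨U, hU, hc, hd, hxU⟩ := exists_choice_avoid h x
  have hUF : ∀ j, U j ⊆ F j := fun j => (hU j).trans Finset.sdiff_subset
  have h1 := card_sdiff_choice U hUF hc hd J
  refine ⟨atomUnion F J \ J.biUnion U, Finset.sdiff_subset, ?_, h1⟩
  refine indepSet_of_disjoint U hUF hc hd _ ?_ ?_ fun j => ?_
  · exact Finset.insert_subset hxE (Finset.sdiff_subset.trans (atomUnion_subset h J))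
  · have := Finset.card_insert_le x (atomUnion F J \ J.biUnion U)
    omega
  · rw [Finset.disjoint_insert_left]
    refine ⟨hxU j, ?_⟩
    by_cases hj : j ∈ J
    · rw [Finset.disjoint_left]
      intro y hy hyU
      exact (mem_sdiff.1 hy).2 (Finset.mem_biUnion.2 ⟨j, hj, hyU⟩)
    · exact ((ownPart_disjoint hj).mono_left (hU j)).symm.mono_left Finset.sdiff_subset

lemma expectedRank_empty : expectedRank F rho ∅ = 0 := by
  simp [expectedRank, atomUnion]

lemma expectedRank_nonneg (h : IsAtomSystem E F rho k) (J : Finset (Fin m)) :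
    0 ≤ expectedRank F rho J := by
  have := expectedRank_mono h (Finset.empty_subset J)
  rwa [expectedRank_empty] at this

lemma eRk_erase (h : IsAtomSystem E F rho k) (J : Finset (Fin m)) (x : α)
    (hx : x ∈ atomUnion F J) :
    (matroidOf h).eRk ((atomUnion F J : Set α) \ {x}) =
      ((min k (expectedRank F rho J)).toNat : ℕ∞) := by
  rw [← Finset.coe_erase]
  have h0 := expectedRank_nonneg h J
  have hk := h.k_pos
  apply eRk_eq_of h
  · obtain ⟨I, h1, h2, h3⟩ := exists_indep_erase h J x hx
    exact ⟨I, h1, h2, by omega⟩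
  · intro I hI hind
    have h1 := card_le_expectedRank hind (hI.trans (Finset.erase_subset _ _))
    have h2 := hind.2.1
    omega

lemma eRk_atomUnion (h : IsAtomSystem E F rho k) (J : Finset (Fin m)) :
    (matroidOf h).eRk (atomUnion F J : Set α) =
      ((min k (expectedRank F rho J)).toNat : ℕ∞) := by
  have h0 := expectedRank_nonneg h J
  have hk := h.k_pos
  apply eRk_eq_of h
  · rcases (atomUnion F J).eq_empty_or_nonempty with he | ⟨x, hx⟩
    · refine ⟨∅, by simp, indepSet_empty h, ?_⟩
      have h1 : expectedRank F rho J ≤ 0 := by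
        unfold expectedRank
        rw [he]
        have := Finset.sum_nonneg (s := J) fun i _ => (atomNullity_pos h i).le
        simpa using this
      rw [Finset.card_empty]
      omega
    · obtain ⟨I, h1, h2, h3⟩ := exists_indep_erase h J x hx
      exact ⟨I, h1.trans (Finset.erase_subset _ _), h2, by omega⟩
  · intro I hI hind
    have h1 := card_le_expectedRank hind hI
    have h2 := hind.2.1
    omega

lemma isCyclic_atomUnion (h : IsAtomSystem E F rho k) (J : Finset (Fin m)) :
    IsCyclic (matroidOf h) (atomUnion F J : Set α) := by
  rw [isCyclic_iff]
  · intro x hx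
    rw [eRk_erase h J x (by exact_mod_cast hx), eRk_atomUnion h J]
  · exact E.finite_toSet
  · rw [matroidOf_ground]
    exact_mod_cast atomUnion_subset h J

lemma isFlat_atomUnion (h : IsAtomSystem E F rho k) {J : Finset (Fin m)}
    (hJ : expectedRank F rho J < k) : (matroidOf h).IsFlat (atomUnion F J : Set α) := by
  have hsub : (atomUnion F J : Set α) ⊆ (matroidOf h).E := by
    rw [matroidOf_ground]
    exact_mod_cast atomUnion_subset h J
  rw [Matroid.isFlat_iff_closure_eq]
  refine Set.Subset.antisymm (fun x hx => ?_) ((matroidOf h).subset_closure _ hsub)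
  by_contra hxJ
  have hxE : x ∈ (matroidOf h).E := Matroid.mem_ground_of_mem_closure hx
  rw [mem_closure_iff_eRk (by exact E.finite_toSet) hsub hxE, eRk_atomUnion h J] at hx
  obtain ⟨I, hI, hind, hc⟩ := exists_indep_insert h J hJ x (by exact_mod_cast hxE)
  have h1 := ((matroidOf_indep h _).2 hind).encard_le_eRk_of_subset
    (X := insert x (atomUnion F J : Set α)) (by
      rw [Finset.coe_insert]
      exact Set.insert_subset_insert (by exact_mod_cast hI))
  rw [hx, Set.encard_coe_eq_coe_finsetCard,
    Finset.card_insert_of_notMem (fun hh => hxJ (by exact_mod_cast hI hh))] at h1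
  have h2 : #I + 1 ≤ (min k (expectedRank F rho J)).toNat := by exact_mod_cast h1
  omega

/-- A cyclic flat other than `E` is one of the sets `F_J` of expected rank below `k`. -/
lemma exists_of_isCyclicFlat (h : IsAtomSystem E F rho k) {X : Finset α} (hXE : X ≠ E)
    (hX : IsCyclicFlat (matroidOf h) (X : Set α)) :
    ∃ J, expectedRank F rho J < k ∧ X = atomUnion F J := by
  obtain ⟨hfl, hcyc⟩ := hX
  have hsub : (X : Set α) ⊆ (matroidOf h).E := hfl.subset_ground
  have hsubE : X ⊆ E := by rw [matroidOf_ground] at hsub; exact_mod_cast hsub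
  rw [isCyclic_iff (by exact E.finite_toSet) hsub] at hcyc
  obtain ⟨I', hI'⟩ := (matroidOf h).exists_isBasis (X : Set α)
  have hI'X := hI'.subset
  lift I' to Finset α using X.finite_toSet.subset hI'X with I
  have hIX : I ⊆ X := by exact_mod_cast hI'X
  have hind : IndepSet E F rho k I := (matroidOf_indep h I).1 hI'.indep
  have hcl : (matroidOf h).closure (I : Set α) = X := by
    rw [hI'.closure_eq_closure, Matroid.isFlat_iff_closure_eq.1 hfl]
  have hmem : ∀ e ∈ E, e ∉ I → (e ∈ X ↔ ¬ IndepSet E F rho k (insert e I)) := by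
    intro e heE heI
    have h1 := hI'.indep.mem_closure_iff' (x := e)
    rw [hcl, ← Finset.coe_insert, matroidOf_indep] at h1
    rw [← Finset.mem_coe, h1]
    constructor
    · rintro ⟨_, h2⟩ h3
      exact heI (by exact_mod_cast h2 h3)
    · intro h2
      exact ⟨by rw [matroidOf_ground]; exact_mod_cast heE, fun h3 => absurd h3 h2⟩
  have hlt : (#I : ℤ) < k := by
    refine lt_of_le_of_ne hind.2.1 fun heq => hXE (Finset.Subset.antisymm hsubE fun e heE => ?_)
    by_cases heI : e ∈ I
    · exact hIX heI
    · rw [hmem e heE heI]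
      intro hh
      have := hh.2.1
      rw [Finset.card_insert_of_notMem heI] at this
      omega
  obtain ⟨J, hJ, hSJ⟩ := exists_tight hind hlt (S := X \ I) (fun e he => by
    have h1 := mem_sdiff.1 he
    exact ⟨hsubE h1.1, h1.2, (hmem e (hsubE h1.1) h1.2).1 h1.1⟩)
  have hJX : atomUnion F J ⊆ X := by
    intro y hy
    by_cases hyI : y ∈ I
    · exact hIX hyI
    · rw [hmem y (atomUnion_subset h J hy) hyI]
      intro hh
      have h1 := hh.2.2 J
      rw [Finset.card_insert_of_notMem hyI] at h1
      have h2 : atomUnion F J ∪ insert y I = atomUnion F J ∪ I := by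
        ext z; simp only [mem_union, mem_insert]
        constructor
        · rintro (hz | rfl | hz)
          · exact Or.inl hz
          · exact Or.inl hy
          · exact Or.inr hz
        · tauto
      rw [h2] at h1
      push_cast at h1
      omega
  have hXeq : X = atomUnion F J ∪ I := by
    apply Finset.Subset.antisymm
    · intro y hy
      by_cases hyI : y ∈ I
      · exact Finset.mem_union_right _ hyI
      · exact Finset.mem_union_left _ (hSJ (mem_sdiff.2 ⟨hy, hyI⟩))
    · exact Finset.union_subset hJX hIX
  have hIJ : I ⊆ atomUnion F J := by
    intro x hx
    by_contra hxJ
    have h1 := hcyc x (by exact_mod_cast hIX hx)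
    rw [← hI'.encard_eq_eRk, Set.encard_coe_eq_coe_finsetCard, ← Finset.coe_erase] at h1
    obtain ⟨K, hKX, hK, hKc⟩ := Matroid.le_eRk_iff.1 h1.ge
    lift K to Finset α using (X.erase x).finite_toSet.subset hKX
    rw [matroidOf_indep] at hK
    rw [Set.encard_coe_eq_coe_finsetCard] at hKc
    have hKc' : #K = #I := by exact_mod_cast hKc
    have h2 := hK.2.2 J
    have h3 : #(atomUnion F J ∪ K) ≤ #(X.erase x) := by
      apply Finset.card_le_card
      apply Finset.union_subset
      · exact fun y hy => Finset.mem_erase.2 ⟨fun hh => hxJ (hh ▸ hy), hJX hy⟩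
      · exact_mod_cast hKX
    have h4 := Finset.card_erase_add_one (hIX hx)
    rw [← hXeq] at hJ
    omega
  rw [Finset.union_eq_left.2 hIJ] at hXeq hJ
  refine ⟨J, ?_, hXeq⟩
  unfold expectedRank
  omega

/-- The data determine a matroid: `M(F_1, …, F_m; k; ρ)` exists. -/
theorem isMatroidOf_matroidOf (h : IsAtomSystem E F rho k) :
    IsMatroidOf (matroidOf h) E F rho k where
  ground_eq := rfl
  isCyclicFlat_iff X := by
    constructor
    · intro hX
      have hsub := hX.1.subset_ground
      rw [matroidOf_ground] at hsub
      lift X to Finset α using E.finite_toSet.subset hsub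
      by_cases hXE : X = E
      · exact Or.inl (by rw [hXE])
      · obtain ⟨J, hJ, rfl⟩ := exists_of_isCyclicFlat h hXE hX
        exact Or.inr ⟨J, (isLow_iff h J).2 hJ, rfl⟩
    · rintro (rfl | ⟨J, hJ, rfl⟩)
      · refine ⟨(matroidOf h).ground_isFlat, ?_⟩
        have := isCyclic_atomUnion h univ
        rwa [h.union_eq] at this
      · exact ⟨isFlat_atomUnion h ((isLow_iff h J).1 hJ), isCyclic_atomUnion h J⟩
  rank_low J hJ := by
    have h1 := (isLow_iff h J).1 hJ
    have h0 := expectedRank_nonneg h J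
    rw [rank, eRk_atomUnion h J, ENat.toNat_natCast]
    omega
  rank_ground := by
    have h1 := h.k_le
    have hk := h.k_pos
    have h2 : k ≤ expectedRank F rho univ := h1
    have h3 := eRk_atomUnion h univ
    rw [congrArg (fun S : Finset α => (S : Set α)) h.union_eq] at h3
    rw [rank, h3, ENat.toNat_natCast]
    omega

end Existence

end LocalMatroid

namespace LocalMatroid

/-! ### Dual circuits and the nullity of cyclic flats in a finite matroid -/

section CyclicFlats

variable {α : Type*} {M : Matroid α}

/-! Circuits of the dual are the minimal sets whose complement does not span. Hence `d = n - k + 1 -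
D`, where `D` is the greatest nullity `|Z| - rank Z` of a cyclic flat `Z ≠ E`. One inequality
extends `Z` to a large non-spanning set (`exists_dual_isCircuit_ncard_le`). The other replaces a
proper flat by the union of its circuits (`exists_isCyclicFlat_of_dual_isCircuit`). In the given
matroid the proper cyclic flats are the `F_J` of expected rank below `k`, and such an `F_J` has
nullity `∑_{i ∈ J} η(F_i)` (`isGreatest_nullity`).

What remains is combinatorial (`nullity_max_eq_iff`). Put `c = ⌈k/r⌉`. The expected rank of `F_J` is
at most `|J| r`, so every `J` with `c - 1` elements is admissible and `D ≥ (c - 1)(δ - 1)`. Equality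
leaves no room for an atom of nullity above `δ - 1`, nor for an admissible `J` with `c` elements.
Conversely, if all nullities are `δ - 1` and no `c`-set is admissible, no larger set is either,
since the expected rank is monotone. -/

lemma rank_eq_ncard_of_isBasis {I X : Set α} (hI : M.IsBasis I X) :
    rank M X = (I.ncard : ℤ) := by
  rw [rank, ← hI.encard_eq_eRk, Set.ncard]

/-- A set of less than full rank yields a dual circuit whose size is bounded in terms of the
nullity of the set. -/
lemma exists_dual_isCircuit_ncard_le (hfin : M.E.Finite) {Z : Set α} (hZ : Z ⊆ M.E)
    (hlt : rank M Z < rank M M.E) :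
    ∃ X, M✶.IsCircuit X ∧
      (X.ncard : ℤ) ≤ M.E.ncard - rank M M.E + 1 - (Z.ncard - rank M Z) := by
  obtain ⟨I, hI⟩ := M.exists_isBasis Z
  obtain ⟨B, hB, hIB⟩ := hI.indep.exists_isBase_superset
  have hBfin : B.Finite := hfin.subset hB.subset_ground
  rw [rank_eq_ncard_of_isBasis hI, rank_eq_ncard_of_isBasis hB.isBasis_ground] at hlt ⊢
  obtain ⟨e, heB, heI⟩ : ∃ e ∈ B, e ∉ I := by
    by_contra! hBI
    have := Set.ncard_le_ncard (t := I) hBI (hBfin.subset hIB)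
    omega
  have hIe : I ⊆ B \ {e} := fun x hx => ⟨hIB hx, fun hxe => heI (hxe ▸ hx)⟩
  -- `I` is already maximal independent in `Z`, so enlarging it to the base `B` adds only elements
  -- outside `Z`.
  have hBZ : B ∩ Z ⊆ I := by
    rintro x ⟨hxB, hxZ⟩
    exact hI.mem_of_insert_indep hxZ (hB.indep.subset (Set.insert_subset hxB hIB))
  -- `Y` lies in the hyperplane spanned by `B \ {e}`, so its complement is codependent; it contains
  -- `Z` together with `rank M - 1 - rank Z` further elements.
  set Y := Z ∪ (B \ {e})
  have hYE : Y ⊆ M.E := Set.union_subset hZ (Set.sdiff_subset.trans hB.subset_ground)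
  have hYcl : Y ⊆ M.closure (B \ {e}) := by
    refine Set.union_subset ?_ (M.subset_closure _ (Set.sdiff_subset.trans hB.subset_ground))
    exact hI.subset_closure.trans (M.closure_subset_closure hIe)
  have hnsp : ¬ M.Spanning Y := by
    intro hsp
    refine hB.indep.notMem_closure_sdiff_of_mem heB ?_
    have h1 := M.closure_subset_closure_of_subset_closure hYcl
    rw [hsp.closure_eq] at h1
    exact h1 (hB.subset_ground heB)
  have hdep : M✶.Dep (M.E \ Y) := by
    rw [Matroid.spanning_iff_compl_coindep hYE] at hnsp
    exact ⟨hnsp, Set.sdiff_subset⟩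
  obtain ⟨X, hXY, hX⟩ := hdep.exists_isCircuit_subset
  refine ⟨X, hX, ?_⟩
  have h1 := Set.ncard_le_ncard hXY (hfin.subset Set.sdiff_subset)
  have h2 := Set.ncard_sdiff_add_ncard_of_subset hYE hfin
  have h3 : B.ncard + Z.ncard ≤ Y.ncard + 1 + I.ncard := by
    have h4 : Disjoint Z ((B \ {e}) \ I) := by
      rw [Set.disjoint_left]
      exact fun x hxZ hx => hx.2 (hBZ ⟨hx.1.1, hxZ⟩)
    have h5 := Set.ncard_union_eq h4 (hfin.subset hZ)
      (hBfin.subset (Set.sdiff_subset.trans Set.sdiff_subset))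
    have h6 : _ ≤ Y.ncard := Set.ncard_le_ncard
      (Set.union_subset_union_right Z (Set.sdiff_subset : (B \ {e}) \ I ⊆ B \ {e}))
      (hfin.subset hYE)
    have h7 := Set.ncard_sdiff_add_ncard_of_subset hIe (hBfin.subset Set.sdiff_subset)
    have h8 := Set.ncard_sdiff_singleton_add_one heB hBfin
    omega
  omega

/-- The union of the circuits inside a proper flat is a cyclic flat whose nullity is at least
that of the flat. -/
lemma exists_isCyclicFlat_of_isFlat (hfin : M.E.Finite) {H : Set α} (hH : M.IsFlat H)
    (hne : H ≠ M.E) :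
    ∃ Z, IsCyclicFlat M Z ∧ Z ≠ M.E ∧
      (H.ncard : ℤ) + 1 - rank M M.E ≤ Z.ncard - rank M Z := by
  have hHE := hH.subset_ground
  have hHfin := hfin.subset hHE
  set Z := ⋃₀ {C | M.IsCircuit C ∧ C ⊆ H} with hZ
  have hZH : Z ⊆ H := Set.sUnion_subset fun C hC => hC.2
  have hcirc : ∀ C, M.IsCircuit C → C ⊆ H → C ⊆ Z :=
    fun C hC hCH => Set.subset_sUnion_of_mem (⟨hC, hCH⟩ : C ∈ {C | M.IsCircuit C ∧ C ⊆ H})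
  -- A circuit that puts `x` into the closure of `Z` lies in `Z ∪ {x}`, hence in the flat `H`, and
  -- so was already part of the union `Z`.
  have hflat : M.IsFlat Z := by
    rw [Matroid.isFlat_iff_closure_eq]
    refine Set.Subset.antisymm (fun x hx => ?_) (M.subset_closure Z (hZH.trans hHE))
    by_contra hxZ
    obtain ⟨C, hCZ, hC, hxC⟩ := (Matroid.mem_closure_iff_exists_isCircuit hxZ).1 hx
    have hxH : x ∈ H := hH.closure ▸ M.closure_subset_closure hZH hx
    exact hxZ (hcirc C hC (hCZ.trans (Set.insert_subset hxH hZH)) hxC)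
  refine ⟨Z, ⟨hflat, _, fun C hC => hC.1, hZ⟩, fun h => hne (hHE.antisymm (h ▸ hZH)), ?_⟩
  obtain ⟨I, hI⟩ := M.exists_isBasis Z (hZH.trans hHE)
  have hJH : I ∪ (H \ Z) ⊆ H := Set.union_subset (hI.subset.trans hZH) Set.sdiff_subset
  -- A circuit inside this set would lie in `H`, hence in `Z`, hence in the independent set `I`.
  have hind : M.Indep (I ∪ (H \ Z)) := by
    by_contra hni
    obtain ⟨C, hCJ, hC⟩ := Matroid.Dep.exists_isCircuit_subset (M := M) ⟨hni, hJH.trans hHE⟩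
    have hCZ := hcirc C hC (hCJ.trans hJH)
    exact hC.not_indep (hI.indep.subset fun x hx =>
      (hCJ hx).elim id fun hx' => absurd (hCZ hx) hx'.2)
  obtain ⟨B, hB, hJB⟩ := hind.exists_isBase_superset
  have hBfin := hfin.subset hB.subset_ground
  -- Equality would make a subset of `H` a base, and the flat `H` would be the whole ground set.
  -- This strictness is the `+ 1` in the bound.
  have hlt : (I ∪ (H \ Z)).ncard < B.ncard := by
    refine Set.ncard_lt_ncard (hJB.ssubset_of_ne fun h => hne ?_) hBfin
    have h1 := M.closure_subset_closure hJH
    rw [h, hB.closure_eq, hH.closure] at h1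
    exact hHE.antisymm h1
  have hd : Disjoint I (H \ Z) := Set.disjoint_sdiff_right.mono_left hI.subset
  rw [Set.ncard_union_eq hd (hHfin.subset (hI.subset.trans hZH))
    (hHfin.subset Set.sdiff_subset)] at hlt
  have h1 := Set.ncard_sdiff_add_ncard_of_subset hZH hHfin
  rw [rank_eq_ncard_of_isBasis hI, rank_eq_ncard_of_isBasis hB.isBasis_ground]
  omega

/-- A dual circuit yields a proper cyclic flat of large nullity. -/
lemma exists_isCyclicFlat_of_dual_isCircuit (hfin : M.E.Finite) {X : Set α}
    (hX : M✶.IsCircuit X) :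
    ∃ Z, IsCyclicFlat M Z ∧ Z ≠ M.E ∧
      (M.E.ncard : ℤ) - rank M M.E + 1 - (Z.ncard - rank M Z) ≤ X.ncard := by
  have hXE : X ⊆ M.E := hX.subset_ground
  have hnsp : ¬ M.Spanning (M.E \ X) := by
    rw [← Matroid.coindep_iff_compl_spanning hXE]
    exact hX.not_indep
  -- The complement of a dual circuit does not span, so its closure is a proper flat with at least
  -- `n - |X|` elements.
  obtain ⟨Z, hZ, hne, hle⟩ := exists_isCyclicFlat_of_isFlat hfin
    (M.isFlat_closure (M.E \ X))
    (fun h => hnsp ((Matroid.spanning_iff_closure_eq Set.sdiff_subset).2 h))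
  refine ⟨Z, hZ, hne, ?_⟩
  have h1 := Set.ncard_le_ncard (M.subset_closure (M.E \ X) Set.sdiff_subset)
    (hfin.subset (M.closure_subset_ground _))
  have h2 := Set.ncard_sdiff_add_ncard_of_subset hXE hfin
  omega

end CyclicFlats

/-! ### The minimum distance as an extremal problem on index sets -/

section Parameters

variable {α : Type*} [DecidableEq α] {m : ℕ} {E : Finset α} {F : Fin m → Finset α}
  {rho : Fin m → ℤ} {M : Matroid α} {n k d r δ : ℤ}

/-- The minimum distance is `n - k + 1` minus the greatest nullity of a set `F_J` of expected rank
below `k`. -/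
lemma isGreatest_nullity (hF : IsAtomSystem E F rho k) (hM : IsMatroidOf M E F rho k)
    (hd : IsLeast {x : ℤ | ∃ X : Set α, M✶.IsCircuit X ∧ (X.ncard : ℤ) = x} d) :
    IsGreatest {x : ℤ | ∃ J, expectedRank F rho J < k ∧ ∑ i ∈ J, atomNullity F rho i = x}
      (#E - k + 1 - d) := by
  have hfin : M.E.Finite := hM.ground_eq ▸ E.finite_toSet
  have hnull : ∀ J, expectedRank F rho J < k →
      ((atomUnion F J : Set α).ncard : ℤ) - rank M (atomUnion F J : Set α) =
        ∑ i ∈ J, atomNullity F rho i := by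
    intro J hJ
    rw [hM.rank_low J ((isLow_iff hF J).2 hJ), Set.ncard_coe_finset, expectedRank]
    ring
  have hcard : (M.E.ncard : ℤ) = #E := by rw [hM.ground_eq, Set.ncard_coe_finset]
  have hrank : rank M M.E = k := by rw [hM.ground_eq, hM.rank_ground]
  have hupper : ∀ J, expectedRank F rho J < k →
      ∑ i ∈ J, atomNullity F rho i ≤ #E - k + 1 - d := by
    intro J hJ
    obtain ⟨X, hX, hle⟩ := exists_dual_isCircuit_ncard_le hfin (Z := (atomUnion F J : Set α))
      (by rw [hM.ground_eq]; exact_mod_cast atomUnion_subset hF J)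
      (by rwa [hM.rank_low J ((isLow_iff hF J).2 hJ), hrank])
    have h1 := hd.2 ⟨X, hX, rfl⟩
    rw [hnull J hJ, hcard, hrank] at hle
    linarith
  refine ⟨?_, fun x ⟨J, hJ, hx⟩ => hx ▸ hupper J hJ⟩
  obtain ⟨X, hX, hXd⟩ := hd.1
  obtain ⟨Z, hZ, hne, hle⟩ := exists_isCyclicFlat_of_dual_isCircuit hfin hX
  rcases (hM.isCyclicFlat_iff Z).1 hZ with rfl | ⟨J, hJ, rfl⟩
  · exact absurd hM.ground_eq.symm hne
  · have hJ' := (isLow_iff hF J).1 hJ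
    refine ⟨J, hJ', le_antisymm (hupper J hJ') ?_⟩
    rw [hnull J hJ', hcard, hrank, hXd] at hle
    linarith

/-- By the union bound `|F_J| ≤ ∑ |F_i|`, the expected rank is at most `∑ ρ(F_i)`. This is the only
way in which `r` enters the argument. -/
lemma expectedRank_le_card_mul (hr : ∀ i, rho i ≤ r) (J : Finset (Fin m)) :
    expectedRank F rho J ≤ #J * r := by
  have h1 : (#(atomUnion F J) : ℤ) ≤ ∑ i ∈ J, (#(F i) : ℤ) := by
    exact_mod_cast Finset.card_biUnion_le
  have h2 : ∑ i ∈ J, rho i ≤ #J * r := by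
    simpa using Finset.sum_le_card_nsmul J rho r fun i _ => hr i
  simp only [expectedRank, atomNullity, Finset.sum_sub_distrib]
  linarith

/-- If every index set of size `c - 1` has expected rank below `k`, the greatest nullity of an
index set of expected rank below `k` is `(c - 1) η` exactly if all nullities equal their lower
bound `η` and no index set of size `c` has expected rank below `k`. -/
lemma nullity_max_eq_iff (hF : IsAtomSystem E F rho k) {η D : ℤ} {c : ℕ} (hη : 0 < η)
    (hle : ∀ i, η ≤ atomNullity F rho i) (hc : 1 < c) (hcm : c ≤ m)
    (hlow : ∀ J : Finset (Fin m), #J + 1 = c → expectedRank F rho J < k)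
    (hD : IsGreatest {x : ℤ | ∃ J, expectedRank F rho J < k ∧
      ∑ i ∈ J, atomNullity F rho i = x} D) :
    D = (c - 1) * η ↔
      (∀ T : Finset (Fin m), #T = c → (#(atomUnion F T) : ℤ) ≥ k + c * η) ∧
        ∀ i, atomNullity F rho i = η := by
  have hsum : (∀ i, atomNullity F rho i = η) →
      ∀ J : Finset (Fin m), ∑ i ∈ J, atomNullity F rho i = #J * η := by
    intro heq J
    simp [heq]
  constructor
  · rintro rfl
    have heq : ∀ i, atomNullity F rho i = η := by
      intro i
      -- Since `1 ≤ c - 1 ≤ m`, some set of `c - 1` indices contains `i`. It is admissible, so its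
      -- excesses over `η`, all nonnegative, have sum at most zero.
      obtain ⟨J, hiJ, -, hJ⟩ := Finset.exists_subsuperset_card_eq (s := {i}) (t := univ)
        (n := c - 1) (Finset.subset_univ _) (by simp; omega) (by simp; omega)
      have h1 := hD.2 ⟨J, hlow J (by omega), rfl⟩
      have h2 : ((c : ℤ) - 1) = #J := by omega
      have h3 : ∑ j ∈ J, (atomNullity F rho j - η) ≤ 0 := by
        rw [Finset.sum_sub_distrib, Finset.sum_const, nsmul_eq_mul, ← h2]
        linarith
      have h4 := Finset.single_le_sum (f := fun j => atomNullity F rho j - η)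
        (fun j _ => sub_nonneg.2 (hle j)) (Finset.singleton_subset_iff.1 hiJ)
      have h5 := hle i
      linarith
    refine ⟨fun T hT => ?_, heq⟩
    -- A smaller union would make `T` admissible, with nullity `c * η` above the maximum `(c - 1) *
    -- η`.
    by_contra! hlt
    have h1 := hsum heq T
    rw [hT] at h1
    have h2 := hD.2 ⟨T, by rw [expectedRank, h1]; linarith, h1⟩
    linarith
  · rintro ⟨hT, heq⟩
    obtain ⟨J, hJ, hJD⟩ := hD.1
    rw [hsum heq J] at hJD
    apply le_antisymm
    -- A maximizer with `c` or more indices would contain a `c`-set of expected rank at least `k`;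
    -- monotonicity would carry this up to `J`.
    · have hJc : #J < c := by
        by_contra! hcJ
        obtain ⟨T, hTJ, hTc⟩ := Finset.exists_subset_card_eq hcJ
        have h1 := expectedRank_mono hF hTJ
        have h2 := hT T hTc
        have h3 : expectedRank F rho T = #(atomUnion F T) - c * η := by
          rw [expectedRank, hsum heq T, hTc]
        linarith
      rw [← hJD]
      exact mul_le_mul_of_nonneg_right (by omega) hη.le
    · obtain ⟨K, -, hK⟩ := Finset.exists_subset_card_eq (s := (univ : Finset (Fin m)))
        (n := c - 1) (by simp; omega)
      have h1 := hD.2 ⟨K, hlow K (by omega), hsum heq K⟩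
      have h2 : ((c : ℤ) - 1) = #K := by omega
      rwa [h2]

end Parameters

end LocalMatroid

/-! ### The characterization of equality -/

theorem mainTheorem4 {α : Type*} [DecidableEq α] {m : ℕ} (E : Finset α) (F : Fin m → Finset α)
    (rho : Fin m → ℤ) (M : Matroid α) (n k d r δ : ℤ)
    (hF : LocalMatroid.IsAtomSystem E F rho k)
    (hM : LocalMatroid.IsMatroidOf M E F rho k)
    (hpar : LocalMatroid.HasParameters M E F rho n k d r δ)
    (hrk : r < k) :
    d = n - k + 1 - (⌈(k : ℚ) / (r : ℚ)⌉ - 1) * (δ - 1) ↔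
      (∀ T : Finset (Fin m), (#T : ℤ) = ⌈(k : ℚ) / (r : ℚ)⌉ →
        (#(LocalMatroid.atomUnion F T) : ℤ) ≥
          ⌈(k : ℚ) / (r : ℚ)⌉ * (r + δ - 1) - (⌈(k : ℚ) / (r : ℚ)⌉ * r - k)) ∧
      ∀ i, LocalMatroid.atomNullity F rho i = δ - 1 := by
  obtain ⟨⟨i₁, hi₁⟩, hr⟩ := hpar.r_isGreatest
  have hr0 : 0 < r := hi₁ ▸ hF.rho_pos i₁
  have hr' : ∀ i, rho i ≤ r := fun i => hr ⟨i, rfl⟩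
  have hδ : 0 < δ - 1 := by
    obtain ⟨i, hi⟩ := hpar.delta_isLeast.1
    exact hi ▸ LocalMatroid.atomNullity_pos hF i
  have hceil : ∀ z : ℤ, ⌈(k : ℚ) / (r : ℚ)⌉ ≤ z ↔ k ≤ z * r := by
    intro z
    rw [Int.ceil_le, div_le_iff₀ (by exact_mod_cast hr0)]
    exact_mod_cast Iff.rfl
  have hc1 : 1 < ⌈(k : ℚ) / (r : ℚ)⌉ := by
    rw [← not_le, hceil]
    omega
  obtain ⟨c, hc⟩ := Int.eq_ofNat_of_zero_le (zero_le_one.trans hc1.le)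
  rw [hc] at hceil hc1 ⊢
  -- `k` is at most the expected rank of the whole index set, hence at most `m * r`; so index sets
  -- of sizes `c - 1` and `c` exist.
  have hcm : c ≤ m := by
    have h1 := LocalMatroid.expectedRank_le_card_mul (F := F) hr' univ
    have h2 := (hceil m).2 (hF.k_le.trans (h1.trans (by simp)))
    exact_mod_cast h2
  -- `c` is the least integer with `k ≤ c * r`, so `(c - 1) * r < k`.
  have hlow : ∀ J : Finset (Fin m), #J + 1 = c → LocalMatroid.expectedRank F rho J < k := by
    intro J hJ
    refine (LocalMatroid.expectedRank_le_card_mul hr' J).trans_lt ?_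
    rw [← not_le, ← hceil]
    omega
  have key := LocalMatroid.nullity_max_eq_iff hF hδ (fun i => hpar.delta_isLeast.2 ⟨i, rfl⟩)
    (by exact_mod_cast hc1) hcm hlow (LocalMatroid.isGreatest_nullity hF hM hpar.d_isLeast)
  -- Subtracting `a` cancels `c * r`: when all nullities are `δ - 1`, condition (i) says that every
  -- `c`-set has expected rank at least `k`.
  have hbound : (c : ℤ) * (r + δ - 1) - (c * r - k) = k + c * (δ - 1) := by ring
  rw [hbound, hpar.n_eq]
  simp only [Nat.cast_inj]
  rw [← key]
  constructor <;> intro h <;> linarith
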